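/- Let $H$ be a real Hilbert space, $G$ a real normed space, $D\subset G$ a nonempty set with the induced topology, and let $$C(p)=\{x\in H : \langle x\mid g_i(p)\rangle=f_i(p)\ (i\in I_1),\ \langle x\mid g_i(p)\rangle\le f_i(p)\ (i\in I_2)\},\qquad p\in D,$$ where $I_1,I_2$ are disjoint finite index sets with $I_1\cup I_2\ne\emptyset$ and $f_i:D\to\mathbb R$, $g_i:D\to H$ are locally Lipschitz on $D$. Write $P(v,p)$ for the projection of $v\in H$ onto $C(p)$, i.e. the minimizer of $\tfrac12\|x-v\|^2$ over $x\in C(p)$. An *equivalent representation* $R$ of $C$ consists of disjoint finite sets $\tilde I_1,\tilde I_2$ with $\tilde I_1\cup\tilde I_2\neq\emptyset$ and locally Lipschitz functions $\tilde f_i:D\to\mathbb R$, $\tilde g_i:D\to H$, $i\in\tilde I_1\cup\tilde I_2$, such that for every $p\in D$ $$C(p)=R(p):=\{x : \langle x\mid\tilde g_i(p)\rangle=\tilde f_i(p)\ (i\in\tilde I_1),\ \langle x\mid\tilde g_i(p)\rangle\le\tilde f_i(p)\ (i\in\tilde I_2)\}.$$ Put $I^R_p(x)=\{i\in\tilde I_1\cup\tilde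 I_2:\langle x\mid\tilde g_i(p)\rangle=\tilde f_i(p)\}$. For $F:D\rightrightarrows H$, let $\liminf_{p\to\bar p}F(p)$ be the set of $y\in H$ such that for every neighbourhood $V$ of $y$ one has $V\cap F(p)\neq\emptyset$ for all $p\in D$ in some neighbourhood of $\bar p$. Let $\bar p\in D$, $\bar v\in H\setminus C(\bar p)$ and $\bar x\in C(\bar p)$. Suppose that there is an equivalent representation $R$ of $C$ such that * (RCRCQ at $(\bar p,\bar x)$) there is a neighbourhood $U_0$ of $\bar p$ in $D$ such that for every $J$ with $\tilde I_1\subset J\subset I^R_{\bar p}(\bar x)$ and every $p\in U_0$, $\operatorname{rank}\{\tilde g_i(p):i\in J\}=\operatorname{rank}\{\tilde g_i(\bar p):i\in J\}$; * ($R$ is a stable representation at $(\bar p,\bar v,\bar x)$) there are $\bar K\subset I^R_{\bar p}(\bar x)\cap\tilde I_2$ and $\bar\lambda_i\in\mathbb R$ ($i\in\tilde I_1\cup\bar K$), with $\bar\lambda_i>0$ for $i\in\bar K$, such that $\tilde g_i(\bar p)$, $i\in\tilde I_1\cup\bar K$, are linearly independent, $\bar v-\bar x=\sum_{i\in\tilde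 I_1\cup\bar K}\bar\lambda_i\tilde g_i(\bar p)$, and for every (possibly empty) $L\subset(I^R_{\bar p}(\bar x)\cap\tilde I_2)\setminus\bar K$ for which $\tilde g_i(\bar p)$, $i\in\tilde I_1\cup\bar K\cup L$, are linearly independent, $\bar x\in\liminf_{p\to\bar p}R_{\bar K,L}(p)$, where $$R_{\bar K,L}(p)=\{x:\langle x\mid\tilde g_i(p)\rangle=\tilde f_i(p)\ (i\in\tilde I_1\cup\bar K\cup L),\ \langle x\mid\tilde g_i(p)\rangle\le\tilde f_i(p)\ (i\in\tilde I_2\setminus(\bar K\cup L))\}.$$ Then there are a neighbourhood $W$ of $\bar v$ in $H$, a neighbourhood $U$ of $\bar p$ in $D$ and a constant $\ell^0>0$ such that $P(v,p)$ exists and is unique for all $v\in H$, $p\in U$, and for all $(v_1,p_1),(v_2,p_2)\in W\times U$ $$\|(v_1-v_2)-2[P(v_1,p_1)-P(v_2,p_2)]\|\le\|v_1-v_2\|+\ell^0\|p_1-p_2\|,$$ and consequently $$\|P(v_1,p_1)-P(v_2,p_2)\|\le\|v_1-v_2\|+\tfrac{\ell^0}{2}\|p_1-p_2\|,$$ so that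 $P$ is Lipschitz on $W\times U$. -/

import Mathlib

open Topology Filter

/-- A finite system of affine constraints on `H` depending on a parameter `p : D`, indexed by the
finite type `ι`: the indices in `I₁` are equality constraints `⟪x, g i p⟫ = f i p`, all the other
indices are inequality constraints `⟪x, g i p⟫ ≤ f i p`. -/
structure ConstraintSystem (ι D H : Type*) where
  /-- indices of the equality constraints -/
  I₁ : Finset ι
  /-- right-hand sides -/
  f : ι → D → ℝ
  /-- normal vectors -/
  g : ι → D → H

namespace ConstraintSystem

/-- Indices of the inequality constraints. -/
def I₂ {ι D H : Type*} [Fintype ι] [DecidableEq ι] (R : ConstraintSystem ι D H) : Finset ι :=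
  R.I₁ᶜ

/-- All functions `f i` and `g i` are locally Lipschitz on the parameter set. -/
def IsLocallyLipschitz {ι D H : Type*} [PseudoEMetricSpace D] [PseudoEMetricSpace H]
    (R : ConstraintSystem ι D H) : Prop :=
  (∀ i, LocallyLipschitz (R.f i)) ∧ ∀ i, LocallyLipschitz (R.g i)

variable {ι κ D H : Type*} [Fintype ι] [DecidableEq ι] [Fintype κ] [DecidableEq κ]
  [NormedAddCommGroup H] [InnerProductSpace ℝ H]

/-- The moving set `C(p)` described by the system. -/
def feasible (R : ConstraintSystem ι D H) (p : D) : Set H :=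
  {x | (∀ i ∈ R.I₁, inner ℝ x (R.g i p) = R.f i p) ∧
       (∀ i ∈ R.I₂, inner ℝ x (R.g i p) ≤ R.f i p)}

/-- The active index set `I_p(x)`. -/
def active (R : ConstraintSystem ι D H) (p : D) (x : H) : Set ι :=
  {i | inner ℝ x (R.g i p) = R.f i p}

/-- The relaxed constant rank constraint qualification at `(p₀, x₀)`. -/
def RCRCQ [TopologicalSpace D] (R : ConstraintSystem ι D H) (p₀ : D) (x₀ : H) : Prop :=
  x₀ ∈ R.feasible p₀ ∧
  ∃ U ∈ 𝓝 p₀, ∀ J : Finset ι, R.I₁ ⊆ J → (J : Set ι) ⊆ R.active p₀ x₀ → ∀ p ∈ U,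
    Module.finrank ℝ (Submodule.span ℝ ((fun i => R.g i p) '' (J : Set ι))) =
      Module.finrank ℝ (Submodule.span ℝ ((fun i => R.g i p₀) '' (J : Set ι)))

/-- `R` is an equivalent representation of the moving set described by `C`. -/
def IsEquivalentRepresentation [PseudoEMetricSpace D] (R : ConstraintSystem κ D H)
    (C : ConstraintSystem ι D H) : Prop :=
  R.IsLocallyLipschitz ∧ ∀ p, R.feasible p = C.feasible p

/-- The system `R_{K,L}`: the constraints with index in `K ∪ L` are turned into equalities. -/
def withEqualities (R : ConstraintSystem ι D H) (K L : Finset ι) : ConstraintSystem ι D H where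
  I₁ := R.I₁ ∪ K ∪ L
  f := R.f
  g := R.g

end ConstraintSystem

/-- The lower Kuratowski limit of the multifunction `F` at `p₀`. -/
def kuratowskiLiminf {D H : Type*} [TopologicalSpace D] [TopologicalSpace H]
    (F : D → Set H) (p₀ : D) : Set H :=
  {y | ∀ V ∈ 𝓝 y, ∃ U ∈ 𝓝 p₀, ∀ p ∈ U, (V ∩ F p).Nonempty}

namespace ConstraintSystem

variable {ι κ D H : Type*} [Fintype ι] [DecidableEq ι] [Fintype κ] [DecidableEq κ]
  [NormedAddCommGroup H] [InnerProductSpace ℝ H]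

/-- `R` is a stable representation, at `(p₀, v₀, x₀)` and with the index set `K`, of the moving set
described by `C`: the vector `v₀ - x₀` is a combination of linearly independent normals
`g i p₀`, `i ∈ I₁ ∪ K`, with `K` consisting of active inequality constraints with positive
coefficients, and `x₀` is in the lower Kuratowski limit of `R_{K,L}` for every admissible `L`
(the empty one included). -/
def IsStableRepresentationWith [PseudoEMetricSpace D] (R : ConstraintSystem κ D H)
    (C : ConstraintSystem ι D H) (p₀ : D) (v₀ x₀ : H) (K : Finset κ) : Prop :=
  R.IsEquivalentRepresentation C ∧ v₀ ∉ C.feasible p₀ ∧ x₀ ∈ C.feasible p₀ ∧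
  K ⊆ R.I₂ ∧ (K : Set κ) ⊆ R.active p₀ x₀ ∧
  LinearIndepOn ℝ (fun i => R.g i p₀) (↑(R.I₁ ∪ K) : Set κ) ∧
  (∃ lam : κ → ℝ, (∀ i ∈ K, 0 < lam i) ∧ v₀ - x₀ = ∑ i ∈ R.I₁ ∪ K, lam i • R.g i p₀) ∧
  ∀ L : Finset κ, L ⊆ R.I₂ \ K → (L : Set κ) ⊆ R.active p₀ x₀ →
    LinearIndepOn ℝ (fun i => R.g i p₀) (↑(R.I₁ ∪ K ∪ L) : Set κ) →
    x₀ ∈ kuratowskiLiminf (R.withEqualities K L).feasible p₀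

/-- `R` is a stable representation of `C` at `(p₀, v₀, x₀)`. -/
def IsStableRepresentation [PseudoEMetricSpace D] (R : ConstraintSystem κ D H)
    (C : ConstraintSystem ι D H) (p₀ : D) (v₀ x₀ : H) : Prop :=
  ∃ K : Finset κ, R.IsStableRepresentationWith C p₀ v₀ x₀ K

/-- `x` solves the problem of minimizing `‖x - v‖² / 2` over `x ∈ C(p)`. -/
def IsSolution (C : ConstraintSystem ι D H) (v : H) (p : D) (x : H) : Prop :=
  x ∈ C.feasible p ∧ IsMinOn (fun y => (1 / 2 : ℝ) * ‖y - v‖ ^ 2) (C.feasible p) x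

/-- The projection `P(v, p)` of `v` onto `C(p)`: the solution of the above problem
(an arbitrary point where there is no solution, that is, where `C(p)` is empty). -/
noncomputable def proj (C : ConstraintSystem ι D H) (v : H) (p : D) : H :=
  Classical.epsilon (C.IsSolution v p)

end ConstraintSystem

/-! For fixed `p` the projection is nonexpansive in `v`, and so is `v ↦ v - 2 P(v, p)`; what remains
is a Lipschitz estimate in `p` for fixed `v` (`exists_eventually_norm_isProjOn_sub_le`).

Project `v` onto `R_{K,∅}(p₁)`. The result `x` is near `x₀` and has multipliers on a linearly
independent active set `J ⊇ I₁ ∪ K`. RCRCQ carries the independence of `J` back to `p₀`, which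
bounds the multipliers uniformly and keeps them close to `lam`, hence positive on `K`. So `x` is
also the projection onto the larger set `R(p₁)` (`exists_eventually_exists_multipliers`).

Now put `L = J \ (I₁ ∪ K)`. The stability hypothesis gives `R_{K,L}` the Aubin property
(`exists_eventually_exists_mem_feasible`), so some `z ∈ R_{K,L}(p₂)` lies within `O(dist p₁ p₂)` of
`x`. With the multipliers of `x`, `z` is the projection onto `R(p₂)` of `z + ∑ μ i • g i p₂`, a
point within `O(dist p₁ p₂)` of `v`. Nonexpansiveness then bounds the distance from `z` to `P(v,
p₂)`. -/

/-! ### Finitely generated cones: Carathéodory, closedness, Farkas. -/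

/-- The combinations of `g i`, `i ∈ J`, with nonnegative coefficients outside of `E`. -/
def finsetCone {κ H : Type*} [DecidableEq κ] [AddCommGroup H] [Module ℝ H]
    (g : κ → H) (E J : Finset κ) : Set H :=
  {w | ∃ μ : κ → ℝ, (∀ i ∈ J \ E, 0 ≤ μ i) ∧ w = ∑ i ∈ J, μ i • g i}

section Cone

variable {κ H : Type*} [DecidableEq κ] [AddCommGroup H] [Module ℝ H]

theorem finsetCone_mono {g : κ → H} {E J J' : Finset κ} (h : J' ⊆ J) :
    finsetCone g E J' ⊆ finsetCone g E J := by
  rintro w ⟨μ, hμ, rfl⟩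
  refine ⟨fun i => if i ∈ J' then μ i else 0, fun i hi => ?_, ?_⟩
  · simp only [Finset.mem_sdiff] at hi hμ
    dsimp only
    split_ifs with h'
    · exact hμ i ⟨h', hi.2⟩
    · exact le_rfl
  · simp only [ite_smul, zero_smul, Finset.sum_ite_mem, Finset.inter_eq_right.2 h]

/-- Ratio test. Independence on `E` forces a dependence relation `c` to be nonzero somewhere outside
`E`, positive after a change of sign. Subtracting the multiple of `c` with the smallest ratio `μ i /
c i` kills one coefficient and keeps the others outside `E` nonnegative. -/
theorem exists_erase_mem_finsetCone {g : κ → H} {E J : Finset κ} (hEJ : E ⊆ J)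
    (hE : LinearIndepOn ℝ g (E : Set κ)) (hJ : ¬ LinearIndepOn ℝ g (J : Set κ))
    {w : H} (hw : w ∈ finsetCone g E J) : ∃ k ∈ J \ E, w ∈ finsetCone g E (J.erase k) := by
  obtain ⟨μ, hμ, rfl⟩ := hw
  obtain ⟨c, hc, i, hi, hci⟩ : ∃ c : κ → ℝ, ∑ i ∈ J, c i • g i = 0 ∧ ∃ i ∈ J \ E, 0 < c i := by
    rw [linearIndepOn_finset_iff] at hE hJ
    push Not at hJ
    obtain ⟨c, hc, i, hi, hci⟩ := hJ
    obtain ⟨j, hj, hcj⟩ : ∃ j ∈ J \ E, c j ≠ 0 := by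
      by_contra! hcon
      have hsum : ∑ i ∈ E, c i • g i = 0 := by
        rw [← hc]
        refine Finset.sum_subset hEJ fun j hj hjE => ?_
        rw [hcon j (Finset.mem_sdiff.2 ⟨hj, hjE⟩), zero_smul]
      by_cases hiE : i ∈ E
      · exact hci (hE c hsum i hiE)
      · exact hci (hcon i (Finset.mem_sdiff.2 ⟨hi, hiE⟩))
    rcases hcj.lt_or_gt with h | h
    · exact ⟨fun i => - c i, by simp [hc], j, hj, by simpa using h⟩
    · exact ⟨c, hc, j, hj, h⟩
  obtain ⟨k, hk, hmin⟩ := Finset.exists_min_image ((J \ E).filter fun i => 0 < c i)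
    (fun i => μ i / c i) ⟨i, by simpa [hci] using hi⟩
  rw [Finset.mem_filter] at hk
  refine ⟨k, hk.1, fun i => μ i - μ k / c k * c i, fun j hj => ?_, ?_⟩
  · have hjJ : j ∈ J \ E := by
      simp only [Finset.mem_sdiff, Finset.mem_erase] at hj ⊢
      exact ⟨hj.1.2, hj.2⟩
    rcases le_or_gt (c j) 0 with h | h
    · have := mul_nonpos_of_nonneg_of_nonpos (div_nonneg (hμ k hk.1) hk.2.le) h
      have := hμ j hjJ
      linarith
    · have := hmin j (Finset.mem_filter.2 ⟨hjJ, h⟩)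
      rw [le_div_iff₀ h] at this
      exact sub_nonneg.2 this
  · rw [Finset.sum_erase]
    · simp only [sub_smul, mul_smul, Finset.sum_sub_distrib, ← Finset.smul_sum, hc, smul_zero,
        sub_zero]
    · simp only [div_mul_cancel₀ _ hk.2.ne', sub_self, zero_smul]

/-- **Carathéodory's theorem** for cones with a linearly independent family of free generators. -/
theorem exists_linearIndepOn_mem_finsetCone {g : κ → H} {E : Finset κ}
    (hE : LinearIndepOn ℝ g (E : Set κ)) {w : H} (J : Finset κ) (hEJ : E ⊆ J)
    (hw : w ∈ finsetCone g E J) :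
    ∃ J' ⊆ J, E ⊆ J' ∧ LinearIndepOn ℝ g (J' : Set κ) ∧ w ∈ finsetCone g E J' := by
  induction J using Finset.strongInduction with
  | H J ih =>
    by_cases hJ : LinearIndepOn ℝ g (J : Set κ)
    · exact ⟨J, subset_rfl, hEJ, hJ, hw⟩
    obtain ⟨k, hk, hwk⟩ := exists_erase_mem_finsetCone hEJ hE hJ hw
    rw [Finset.mem_sdiff] at hk
    obtain ⟨J', h1, h2⟩ := ih (J.erase k) (Finset.erase_ssubset hk.1)
      (Finset.subset_erase.2 ⟨hEJ, hk.2⟩) hwk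
    exact ⟨J', h1.trans (Finset.erase_subset _ _), h2⟩

theorem convex_finsetCone (g : κ → H) (E J : Finset κ) : Convex ℝ (finsetCone g E J) := by
  rintro _ ⟨μ, hμ, rfl⟩ _ ⟨ν, hν, rfl⟩ a b ha hb -
  refine ⟨fun i => a * μ i + b * ν i, fun i hi => ?_, ?_⟩
  · exact add_nonneg (mul_nonneg ha (hμ i hi)) (mul_nonneg hb (hν i hi))
  · simp only [add_smul, mul_smul, Finset.sum_add_distrib, Finset.smul_sum]

theorem add_mem_finsetCone {g : κ → H} {E J : Finset κ} {w z : H} (hw : w ∈ finsetCone g E J)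
    (hz : z ∈ finsetCone g E J) : w + z ∈ finsetCone g E J := by
  obtain ⟨μ, hμ, rfl⟩ := hw
  obtain ⟨ν, hν, rfl⟩ := hz
  exact ⟨fun i => μ i + ν i, fun i hi => add_nonneg (hμ i hi) (hν i hi), by
    simp only [add_smul, Finset.sum_add_distrib]⟩

theorem mem_finsetCone_of_mem {g : κ → H} {E J : Finset κ} {i : κ} (hi : i ∈ J) :
    g i ∈ finsetCone g E J :=
  ⟨fun j => if j = i then 1 else 0, fun j _ => by dsimp only; split_ifs <;> norm_num, by
    simp [ite_smul, Finset.sum_ite_eq', hi]⟩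

theorem neg_mem_finsetCone_of_mem {g : κ → H} {E J : Finset κ} {i : κ} (hi : i ∈ J) (hE : i ∈ E) :
    - g i ∈ finsetCone g E J :=
  ⟨fun j => if j = i then -1 else 0, fun j hj => by
    have : j ≠ i := fun h => (Finset.mem_sdiff.1 hj).2 (h ▸ hE)
    simp [this], by
    simp [ite_smul, Finset.sum_ite_eq', hi]⟩

end Cone

section

variable {κ H : Type*} [DecidableEq κ] [NormedAddCommGroup H]

/-- The cone is the image of a closed set of coefficients under an injective linear map from a
finite-dimensional space, which is a closed embedding. -/
theorem isClosed_finsetCone_of_linearIndepOn [NormedSpace ℝ H] {g : κ → H} {E J : Finset κ}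
    (hJ : LinearIndepOn ℝ g (J : Set κ)) : IsClosed (finsetCone g E J) := by
  let T : (J → ℝ) →ₗ[ℝ] H := Fintype.linearCombination ℝ (fun i : J => g i)
  have hT : LinearMap.ker T = ⊥ := by
    rw [LinearMap.ker_eq_bot]
    exact LinearIndependent.fintypeLinearCombination_injective hJ
  have hcl : IsClosed {a : J → ℝ | ∀ i : J, (i : κ) ∉ E → 0 ≤ a i} := by
    simp only [Set.ofPred_forall]
    exact isClosed_iInter fun i => isClosed_iInter fun _ =>
      isClosed_le continuous_const (continuous_apply i)
  have := (LinearMap.isClosedEmbedding_of_injective hT).isClosedMap _ hcl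
  convert this using 1
  ext w
  constructor
  · rintro ⟨μ, hμ, rfl⟩
    refine ⟨fun i => μ i, fun i hi => hμ i (Finset.mem_sdiff.2 ⟨i.2, hi⟩), ?_⟩
    simp only [T, Fintype.linearCombination_apply]
    exact Finset.sum_coe_sort J fun i => μ i • g i
  · rintro ⟨a, ha, rfl⟩
    refine ⟨fun i => if h : i ∈ J then a ⟨i, h⟩ else 0, fun i hi => ?_, ?_⟩
    · rw [Finset.mem_sdiff] at hi
      simpa [hi.1] using ha ⟨i, hi.1⟩ hi.2
    · simp only [T, Fintype.linearCombination_apply]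
      rw [← Finset.sum_coe_sort J]
      simp

/-- By Carathéodory the cone is a finite union of cones with independent generators. -/
theorem isClosed_finsetCone [NormedSpace ℝ H] {g : κ → H} {E J : Finset κ} (hEJ : E ⊆ J)
    (hE : LinearIndepOn ℝ g (E : Set κ)) : IsClosed (finsetCone g E J) := by
  have : finsetCone g E J = ⋃ J' ∈ {J' | J' ∈ J.powerset ∧ LinearIndepOn ℝ g (J' : Set κ)},
      finsetCone g E J' := by
    ext w
    simp only [Set.mem_iUnion, Set.mem_ofPred_eq, Finset.mem_powerset, exists_prop]
    constructor
    · intro hw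
      obtain ⟨J', h1, -, h2, h3⟩ := exists_linearIndepOn_mem_finsetCone hE J hEJ hw
      exact ⟨J', ⟨h1, h2⟩, h3⟩
    · rintro ⟨J', ⟨h1, -⟩, h3⟩
      exact finsetCone_mono h1 h3
  rw [this]
  exact (J.powerset.finite_toSet.subset fun _ h => h.1).isClosed_biUnion fun J' h =>
    isClosed_finsetCone_of_linearIndepOn h.2

/-- **Farkas' lemma** with a linearly independent family of equality constraints. -/
theorem mem_finsetCone_of_forall_inner_nonpos [InnerProductSpace ℝ H] [CompleteSpace H]
    {g : κ → H} {E J : Finset κ} (hEJ : E ⊆ J) (hE : LinearIndepOn ℝ g (E : Set κ)) {w : H}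
    (hw : ∀ d : H, (∀ i ∈ E, inner ℝ d (g i) = 0) → (∀ i ∈ J, inner ℝ d (g i) ≤ 0) →
      inner ℝ w d ≤ 0) : w ∈ finsetCone g E J := by
  have hne : (0 : H) ∈ finsetCone g E J := ⟨0, by simp, by simp⟩
  obtain ⟨n, hn, hmin⟩ := exists_norm_eq_iInf_of_complete_convex ⟨0, hne⟩
    (isClosed_finsetCone hEJ hE).isComplete (convex_finsetCone g E J) w
  rw [norm_eq_iInf_iff_real_inner_le_zero (convex_finsetCone g E J) hn] at hmin
  -- With `n` the projection of `w` onto the cone, the residual `w - n` lies in the polar cone, so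
  -- it is an admissible test direction `d`; this forces it to vanish.
  have hle : ∀ y ∈ finsetCone g E J, inner ℝ (w - n) y ≤ 0 := fun y hy => by
    simpa using hmin (n + y) (add_mem_finsetCone hn hy)
  have hn0 : 0 ≤ inner ℝ (w - n) n := by simpa using hmin 0 hne
  have hd := hw (w - n) (fun i hi => le_antisymm (hle _ (mem_finsetCone_of_mem (hEJ hi))) (by
    simpa using hle _ (neg_mem_finsetCone_of_mem (hEJ hi) hi)))
    fun i hi => hle _ (mem_finsetCone_of_mem hi)
  have h0 : inner ℝ (w - n) (w - n) ≤ (0 : ℝ) := by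
    rw [inner_sub_right, real_inner_comm]
    linarith
  have : w - n = 0 := real_inner_self_nonpos.1 h0
  rwa [sub_eq_zero.1 this]

end

/-! ### Projections onto convex sets. -/

/-- Variational characterization of `x` being the projection of `v` onto the convex set `S`. -/
def IsProjOn {H : Type*} [NormedAddCommGroup H] [InnerProductSpace ℝ H] (S : Set H) (v x : H) :
    Prop :=
  x ∈ S ∧ ∀ y ∈ S, inner ℝ (v - x) (y - x) ≤ 0

namespace IsProjOn

variable {H : Type*} [NormedAddCommGroup H] [InnerProductSpace ℝ H] {S : Set H} {v w x y : H}

theorem norm_sq_le_inner (hx : IsProjOn S v x) (hy : IsProjOn S w y) :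
    ‖x - y‖ ^ 2 ≤ inner ℝ (v - w) (x - y) := by
  have h1 := hx.2 y hy.1
  have h2 := hy.2 x hx.1
  rw [← real_inner_self_eq_norm_sq]
  simp only [inner_sub_left, inner_sub_right] at *
  linarith

theorem norm_reflection_le (hx : IsProjOn S v x) (hy : IsProjOn S w y) :
    ‖(v - w) - (2 : ℝ) • (x - y)‖ ≤ ‖v - w‖ := by
  have h := hx.norm_sq_le_inner hy
  refine (sq_le_sq₀ (norm_nonneg _) (norm_nonneg _)).1 ?_
  rw [norm_sub_sq_real, inner_smul_right, norm_smul, mul_pow, Real.norm_eq_abs, sq_abs]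
  linarith

theorem norm_sub_le (hx : IsProjOn S v x) (hy : IsProjOn S w y) : ‖x - y‖ ≤ ‖v - w‖ := by
  have h := hx.norm_sq_le_inner hy
  have h' := real_inner_le_norm (v - w) (x - y)
  rcases (norm_nonneg (x - y)).eq_or_lt with h0 | h0
  · rw [← h0]
    exact norm_nonneg _
  · nlinarith

theorem unique (hx : IsProjOn S v x) (hy : IsProjOn S v y) : x = y := by
  have := hx.norm_sub_le hy
  rw [sub_self, norm_zero] at this
  exact sub_eq_zero.1 (norm_le_zero_iff.1 this)

end IsProjOn

section

variable {H : Type*} [NormedAddCommGroup H] [InnerProductSpace ℝ H] {S : Set H} {v x : H}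

theorem exists_isProjOn [CompleteSpace H] (hne : S.Nonempty) (hcl : IsClosed S)
    (hconv : Convex ℝ S) (v : H) : ∃ x, IsProjOn S v x := by
  obtain ⟨x, hx, hmin⟩ := exists_norm_eq_iInf_of_complete_convex hne hcl.isComplete hconv v
  exact ⟨x, hx, (norm_eq_iInf_iff_real_inner_le_zero hconv hx).1 hmin⟩

theorem isProjOn_iff_isMinOn (hconv : Convex ℝ S) :
    IsProjOn S v x ↔ x ∈ S ∧ IsMinOn (fun y => (1 / 2 : ℝ) * ‖y - v‖ ^ 2) S x := by
  refine and_congr_right fun hx => ?_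
  rw [← norm_eq_iInf_iff_real_inner_le_zero hconv hx, isMinOn_iff]
  have : Nonempty S := ⟨⟨x, hx⟩⟩
  have hbdd : BddBelow (Set.range fun w : S => ‖v - w‖) :=
    ⟨0, Set.forall_mem_range.2 fun _ => norm_nonneg _⟩
  constructor
  · intro h y hy
    have : ‖v - x‖ ≤ ‖v - y‖ := h.trans_le (ciInf_le hbdd ⟨y, hy⟩)
    rw [norm_sub_rev v x, norm_sub_rev v y] at this
    gcongr
  · intro h
    refine le_antisymm (le_ciInf fun y => ?_) (ciInf_le hbdd ⟨x, hx⟩)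
    have := h y y.2
    rw [norm_sub_rev v x, norm_sub_rev v y]
    refine (sq_le_sq₀ (norm_nonneg _) (norm_nonneg _)).1 ?_
    linarith

end

/-! ### Karush-Kuhn-Tucker conditions for the constraint system. -/

namespace ConstraintSystem

theorem mem_I₂ {κ D H : Type*} [Fintype κ] [DecidableEq κ] (R : ConstraintSystem κ D H) {i : κ} :
    i ∈ R.I₂ ↔ i ∉ R.I₁ :=
  Finset.mem_compl

variable {κ D H : Type*} [Fintype κ] [DecidableEq κ] [NormedAddCommGroup H]
  [InnerProductSpace ℝ H] (R : ConstraintSystem κ D H) {p : D} {v x y : H}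

theorem convex_feasible (p : D) : Convex ℝ (R.feasible p) := by
  rintro x ⟨hx1, hx2⟩ y ⟨hy1, hy2⟩ a b ha hb hab
  refine ⟨fun i hi => ?_, fun i hi => ?_⟩
  · rw [inner_add_left, real_inner_smul_left, real_inner_smul_left, hx1 i hi, hy1 i hi, ← add_mul,
      hab, one_mul]
  · rw [inner_add_left, real_inner_smul_left, real_inner_smul_left]
    calc a * inner ℝ x (R.g i p) + b * inner ℝ y (R.g i p)
        ≤ a * R.f i p + b * R.f i p := by gcongr; exacts [hx2 i hi, hy2 i hi]
      _ = R.f i p := by rw [← add_mul, hab, one_mul]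

theorem isClosed_feasible (p : D) : IsClosed (R.feasible p) := by
  have : R.feasible p = (⋂ i ∈ R.I₁, {x : H | inner ℝ x (R.g i p) = R.f i p}) ∩
      ⋂ i ∈ R.I₂, {x : H | inner ℝ x (R.g i p) ≤ R.f i p} := by
    ext x
    simp [feasible]
  rw [this]
  refine IsClosed.inter ?_ ?_
  · exact isClosed_biInter fun i _ => isClosed_eq (by fun_prop) continuous_const
  · exact isClosed_biInter fun i _ => isClosed_le (by fun_prop) continuous_const

theorem isSolution_iff : R.IsSolution v p x ↔ IsProjOn (R.feasible p) v x :=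
  (isProjOn_iff_isMinOn (R.convex_feasible p)).symm

variable {R}

theorem inner_le_of_mem_feasible (hx : x ∈ R.feasible p) (i : κ) :
    inner ℝ x (R.g i p) ≤ R.f i p := by
  by_cases hi : i ∈ R.I₁
  · exact (hx.1 i hi).le
  · exact hx.2 i (R.mem_I₂.2 hi)

theorem isProjOn_proj (h : ∃ x, IsProjOn (R.feasible p) v x) :
    IsProjOn (R.feasible p) v (R.proj v p) := by
  rw [← isSolution_iff]
  simp only [← isSolution_iff] at h
  exact Classical.epsilon_spec h

/-- Sufficiency of the Karush-Kuhn-Tucker conditions. -/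
theorem isProjOn_of_mem_finsetCone {J : Finset κ} (hx : x ∈ R.feasible p)
    (hJ : (J : Set κ) ⊆ R.active p x) (hv : v - x ∈ finsetCone (fun i => R.g i p) R.I₁ J) :
    IsProjOn (R.feasible p) v x := by
  obtain ⟨μ, hμ, hv⟩ := hv
  refine ⟨hx, fun y hy => ?_⟩
  rw [hv, sum_inner]
  refine Finset.sum_nonpos fun i hi => ?_
  have hxi : inner ℝ x (R.g i p) = R.f i p := hJ hi
  rw [real_inner_smul_left, real_inner_comm, inner_sub_left, hxi]
  by_cases hi1 : i ∈ R.I₁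
  · rw [hy.1 i hi1]
    simp
  · exact mul_nonpos_of_nonneg_of_nonpos (hμ i (Finset.mem_sdiff.2 ⟨hi, hi1⟩))
      (sub_nonpos.2 (inner_le_of_mem_feasible hy i))

theorem I₁_subset_active (hx : x ∈ R.feasible p) : (R.I₁ : Set κ) ⊆ R.active p x :=
  fun i hi => hx.1 i hi

/-- Necessity of the Karush-Kuhn-Tucker conditions, with linearly independent active normals. -/
theorem exists_linearIndepOn_mem_finsetCone_of_isProjOn [CompleteSpace H]
    (hlin : LinearIndepOn ℝ (fun i => R.g i p) (R.I₁ : Set κ))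
    (hx : IsProjOn (R.feasible p) v x) :
    ∃ J : Finset κ, R.I₁ ⊆ J ∧ (J : Set κ) ⊆ R.active p x ∧
      LinearIndepOn ℝ (fun i => R.g i p) (J : Set κ) ∧
      v - x ∈ finsetCone (fun i => R.g i p) R.I₁ J := by
  classical
  let A : Finset κ := Finset.univ.filter fun i => i ∈ R.active p x
  have hA : ∀ i, i ∈ A ↔ inner ℝ x (R.g i p) = R.f i p := fun i => by
    simp only [A, Finset.mem_filter, Finset.mem_univ, true_and]
    rfl
  have hIA : R.I₁ ⊆ A := fun i hi => (hA i).2 (hx.1.1 i hi)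
  have hmem : v - x ∈ finsetCone (fun i => R.g i p) R.I₁ A := by
    refine mem_finsetCone_of_forall_inner_nonpos hIA hlin fun d hd1 hd2 => ?_
    have hev : ∀ i, ∀ᶠ t : ℝ in 𝓝[>] 0, inner ℝ (x + t • d) (R.g i p) ≤ R.f i p := fun i => by
      by_cases hi : i ∈ A
      · filter_upwards [self_mem_nhdsWithin] with t ht
        rw [inner_add_left, real_inner_smul_left, (hA i).1 hi]
        have := mul_nonpos_of_nonneg_of_nonpos (le_of_lt ht) (hd2 i hi)
        linarith
      · have hlt : inner ℝ (x + (0 : ℝ) • d) (R.g i p) < R.f i p := by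
          rw [zero_smul, add_zero]
          exact (inner_le_of_mem_feasible hx.1 i).lt_of_ne (mt (hA i).2 hi)
        have hcont : Continuous fun t : ℝ => inner ℝ (x + t • d) (R.g i p) := by fun_prop
        exact nhdsWithin_le_nhds
          (((hcont.tendsto 0).eventually_lt_const hlt).mono fun _ h => h.le)
    obtain ⟨t, ht, ht0⟩ := ((eventually_all.2 hev).and self_mem_nhdsWithin).exists
    have hfeas : x + t • d ∈ R.feasible p := ⟨fun i hi => by
      rw [inner_add_left, real_inner_smul_left, hd1 i hi, hx.1.1 i hi, mul_zero, add_zero],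
      fun i _ => ht i⟩
    have := hx.2 _ hfeas
    rw [add_sub_cancel_left, real_inner_smul_right] at this
    exact nonpos_of_mul_nonpos_right this ht0
  obtain ⟨J, h1, h2, h3, h4⟩ := exists_linearIndepOn_mem_finsetCone hlin A hIA hmem
  exact ⟨J, h2, fun i hi => (hA i).1 (h1 hi), h3, h4⟩

end ConstraintSystem

/-! ### Uniform bounds on coefficients near the reference parameter. -/

theorem exists_uniform_constant {α β : Type*} [Finite α] {l : Filter β} {P : α → ℝ → β → Prop}
    (hmono : ∀ a c d b, c ≤ d → P a c b → P a d b) (h : ∀ a, ∃ c, ∀ᶠ b in l, P a c b) :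
    ∃ c, 0 ≤ c ∧ ∀ᶠ b in l, ∀ a, P a c b := by
  choose c hc using h
  obtain ⟨C, hC⟩ := (Set.finite_range c).bddAbove
  refine ⟨max C 0, le_max_right _ _, eventually_all.2 fun a => (hc a).mono fun b hb => ?_⟩
  exact hmono a _ _ b ((hC (Set.mem_range_self a)).trans (le_max_left _ _)) hb

theorem eventually_inter_nonempty_of_mem_kuratowskiLiminf {D H : Type*} [TopologicalSpace D]
    [TopologicalSpace H] {F : D → Set H} {p₀ : D} {y : H} (hy : y ∈ kuratowskiLiminf F p₀)
    {V : Set H} (hV : V ∈ 𝓝 y) : ∀ᶠ p in 𝓝 p₀, (V ∩ F p).Nonempty := by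
  obtain ⟨U, hU, h⟩ := hy V hV
  exact mem_of_superset hU h

/-- A finite family is independent exactly when its rank is the number of indices. -/
theorem linearIndepOn_iff_of_finrank_span_eq {κ H : Type*} [AddCommGroup H] [Module ℝ H]
    {g h : κ → H} {J : Finset κ}
    (hgh : Module.finrank ℝ (Submodule.span ℝ (g '' (J : Set κ))) =
      Module.finrank ℝ (Submodule.span ℝ (h '' (J : Set κ)))) :
    LinearIndepOn ℝ g (J : Set κ) ↔ LinearIndepOn ℝ h (J : Set κ) := by
  unfold LinearIndepOn
  rw [linearIndependent_iff_card_eq_finrank_span, linearIndependent_iff_card_eq_finrank_span,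
    Set.finrank, Set.finrank, ← Set.image_eq_range, ← Set.image_eq_range, hgh]

section Coefficients

variable {κ X H : Type*} [NormedAddCommGroup H] [NormedSpace ℝ H]

theorem exists_sum_abs_le_of_linearIndepOn {g : κ → H} {J : Finset κ}
    (hJ : LinearIndepOn ℝ g (J : Set κ)) :
    ∃ M : ℝ, 0 < M ∧ ∀ μ : κ → ℝ, ∑ i ∈ J, |μ i| ≤ M * ‖∑ i ∈ J, μ i • g i‖ := by
  let T : (J → ℝ) →ₗ[ℝ] H := Fintype.linearCombination ℝ (fun i : J => g i)
  have hT : LinearMap.ker T = ⊥ := by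
    rw [LinearMap.ker_eq_bot]
    exact LinearIndependent.fintypeLinearCombination_injective hJ
  obtain ⟨C, hC0, hC⟩ := T.exists_antilipschitzWith hT
  refine ⟨J.card * C + 1, by positivity, fun μ => ?_⟩
  have h1 : ‖fun i : J => μ i‖ ≤ C * ‖∑ i ∈ J, μ i • g i‖ := by
    have := hC.le_mul_norm_sub (fun i : J => μ i) 0
    simp only [map_zero, add_zero, norm_neg] at this
    rwa [show T (fun i : J => μ i) = ∑ i ∈ J, μ i • g i from
      (Fintype.linearCombination_apply ..).trans (Finset.sum_coe_sort J fun i => μ i • g i)] at this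
  have h2 : ∑ i ∈ J, |μ i| ≤ J.card * ‖fun i : J => μ i‖ := by
    rw [← nsmul_eq_mul]
    refine Finset.sum_le_card_nsmul _ _ _ fun i hi => ?_
    exact norm_le_pi_norm (fun i : J => μ i) ⟨i, hi⟩
  have h3 := mul_le_mul_of_nonneg_left h1 (Nat.cast_nonneg (α := ℝ) J.card)
  nlinarith [norm_nonneg (∑ i ∈ J, μ i • g i)]

theorem linearIndepOn_of_sum_abs_le {g : κ → H} {J : Finset κ} {M : ℝ}
    (h : ∀ μ : κ → ℝ, ∑ i ∈ J, |μ i| ≤ M * ‖∑ i ∈ J, μ i • g i‖) :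
    LinearIndepOn ℝ g (J : Set κ) := by
  rw [linearIndepOn_finset_iff]
  intro μ hμ i hi
  have := h μ
  rw [hμ, norm_zero, mul_zero] at this
  exact abs_nonpos_iff.1 ((Finset.single_le_sum (fun i _ => abs_nonneg (μ i)) hi).trans this)

theorem norm_sum_smul_le {h : κ → H} {J : Finset κ} {ε : ℝ} (hh : ∀ i ∈ J, ‖h i‖ ≤ ε)
    (μ : κ → ℝ) : ‖∑ i ∈ J, μ i • h i‖ ≤ (∑ i ∈ J, |μ i|) * ε := by
  refine (norm_sum_le _ _).trans ?_
  rw [Finset.sum_mul]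
  refine Finset.sum_le_sum fun i hi => ?_
  rw [norm_smul, Real.norm_eq_abs]
  exact mul_le_mul_of_nonneg_left (hh i hi) (abs_nonneg _)

/-- A perturbation of each vector by at most `1 / (2 * M)` costs half of the coefficient sum, which
is absorbed by doubling the constant. -/
theorem exists_eventually_sum_abs_le [TopologicalSpace X] {g : κ → X → H} {p₀ : X}
    (hg : ∀ i, ContinuousAt (g i) p₀) {J : Finset κ}
    (hJ : LinearIndepOn ℝ (fun i => g i p₀) (J : Set κ)) :
    ∃ M : ℝ, ∀ᶠ p in 𝓝 p₀, ∀ μ : κ → ℝ, ∑ i ∈ J, |μ i| ≤ M * ‖∑ i ∈ J, μ i • g i p‖ := by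
  obtain ⟨M, hM, h⟩ := exists_sum_abs_le_of_linearIndepOn hJ
  refine ⟨2 * M, ?_⟩
  have hev : ∀ᶠ p in 𝓝 p₀, ∀ i ∈ J, ‖g i p₀ - g i p‖ ≤ 1 / (2 * M) := by
    refine (Finset.eventually_all J).2 fun i _ => ?_
    have hc : Tendsto (fun p => ‖g i p₀ - g i p‖) (𝓝 p₀) (𝓝 0) := by
      have := (tendsto_const_nhds (x := g i p₀)).sub (hg i).tendsto
      simpa using this.norm
    exact (hc.eventually_lt_const (by positivity)).mono fun _ h => h.le
  filter_upwards [hev] with p hp μ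
  have h1 := norm_sum_smul_le hp μ
  have h2 : ‖∑ i ∈ J, μ i • g i p₀‖ ≤
      ‖∑ i ∈ J, μ i • g i p‖ + ‖∑ i ∈ J, μ i • (g i p₀ - g i p)‖ := by
    refine le_trans (le_of_eq ?_) (norm_add_le _ _)
    rw [← Finset.sum_add_distrib]
    simp only [← smul_add, add_sub_cancel]
  have h3 := mul_le_mul_of_nonneg_left (h2.trans (add_le_add_right h1 _)) hM.le
  have h4 : M * ((∑ i ∈ J, |μ i|) * (1 / (2 * M))) = (∑ i ∈ J, |μ i|) / 2 := by
    field_simp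
  have := h μ
  rw [mul_add, h4] at h3
  linarith

theorem exists_eventually_forall_sum_abs_le [Finite κ] [TopologicalSpace X] {g : κ → X → H}
    {p₀ : X} (hg : ∀ i, ContinuousAt (g i) p₀) :
    ∃ M : ℝ, 0 ≤ M ∧ ∀ᶠ p in 𝓝 p₀, ∀ J : Finset κ,
      LinearIndepOn ℝ (fun i => g i p₀) (J : Set κ) →
      ∀ μ : κ → ℝ, ∑ i ∈ J, |μ i| ≤ M * ‖∑ i ∈ J, μ i • g i p‖ := by
  refine exists_uniform_constant ?_ fun J => ?_
  · intro J c d p hcd h hJ μ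
    exact (h hJ μ).trans (mul_le_mul_of_nonneg_right hcd (norm_nonneg _))
  · by_cases hJ : LinearIndepOn ℝ (fun i => g i p₀) (J : Set κ)
    · obtain ⟨M, hM⟩ := exists_eventually_sum_abs_le hg hJ
      exact ⟨M, hM.mono fun p hp _ => hp⟩
    · exact ⟨0, Eventually.of_forall fun p h => absurd h hJ⟩

end Coefficients

/-! ### Stability of active sets, projections and ranks near the reference point. -/

namespace ConstraintSystem

theorem feasible_withEqualities_subset {κ D H : Type*} [Fintype κ] [DecidableEq κ]
    [NormedAddCommGroup H] [InnerProductSpace ℝ H] {R : ConstraintSystem κ D H} (K L : Finset κ)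
    (p : D) : (R.withEqualities K L).feasible p ⊆ R.feasible p := fun _ hx =>
  ⟨fun i hi => hx.1 i (Finset.mem_union_left _ (Finset.mem_union_left _ hi)),
    fun i _ => inner_le_of_mem_feasible hx i⟩

theorem eventually_active_subset {κ D H : Type*} [Finite κ] [NormedAddCommGroup H]
    [InnerProductSpace ℝ H] [TopologicalSpace D] {R : ConstraintSystem κ D H} {p₀ : D}
    (hf : ∀ i, ContinuousAt (R.f i) p₀)
    (hg : ∀ i, ContinuousAt (R.g i) p₀) (x₀ : H) :
    ∀ᶠ q : D × H in 𝓝 (p₀, x₀), R.active q.1 q.2 ⊆ R.active p₀ x₀ := by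
  have : ∀ i, ∀ᶠ q : D × H in 𝓝 (p₀, x₀), i ∈ R.active q.1 q.2 → i ∈ R.active p₀ x₀ := fun i => by
    by_cases hi : i ∈ R.active p₀ x₀
    · exact Eventually.of_forall fun _ _ => hi
    have h1 : ContinuousAt (fun q : D × H => inner ℝ q.2 (R.g i q.1)) (p₀, x₀) :=
      ContinuousAt.inner continuousAt_snd ((hg i).comp_of_eq continuousAt_fst rfl)
    have h2 : ContinuousAt (fun q : D × H => R.f i q.1) (p₀, x₀) :=
      (hf i).comp_of_eq continuousAt_fst rfl
    exact ((h1.sub h2).tendsto.eventually_ne (sub_ne_zero.2 hi)).mono fun q hq h =>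
      absurd (sub_eq_zero.2 h) hq
  exact (eventually_all.2 this).mono fun q hq i => hq i

section Continuity

variable {κ D H : Type*} [Fintype κ] [DecidableEq κ] [NormedAddCommGroup H]
  [InnerProductSpace ℝ H] [TopologicalSpace D] {R : ConstraintSystem κ D H} {p₀ : D} {x₀ : H}

/-- Projections onto `R.feasible p` of points near `v₀` are near `x₀` if `v₀ - x₀` is normal at
`x₀` to the affine space of the equality constraints. -/
theorem eventually_isProjOn_mem (hg : ∀ i, ContinuousAt (R.g i) p₀)
    (hlim : x₀ ∈ kuratowskiLiminf R.feasible p₀) {v₀ : H} {lam : κ → ℝ}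
    (hv : v₀ - x₀ = ∑ i ∈ R.I₁, lam i • R.g i p₀) {V : Set H} (hV : V ∈ 𝓝 x₀) :
    ∀ᶠ q : D × H in 𝓝 (p₀, v₀), ∀ z, IsProjOn (R.feasible q.1) q.2 z → z ∈ V := by
  obtain ⟨ε, hε, hball⟩ := Metric.mem_nhds_iff.1 hV
  have h1 := eventually_inter_nonempty_of_mem_kuratowskiLiminf hlim
    (Metric.ball_mem_nhds x₀ (show 0 < ε / 4 by positivity))
  have hcont : ContinuousAt (fun q : D × H => q.2 - ∑ i ∈ R.I₁, lam i • R.g i q.1) (p₀, v₀) :=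
    continuousAt_snd.sub (tendsto_finsetSum _ fun i _ =>
      tendsto_const_nhds.smul ((hg i).comp_of_eq continuousAt_fst rfl))
  have h2 := hcont (Metric.ball_mem_nhds _ (show 0 < ε / 4 by positivity))
  simp only [← hv, sub_sub_cancel] at h2
  filter_upwards [h2, continuousAt_fst.eventually h1] with q hq2 hq1 z hz
  obtain ⟨y, hy, hyf⟩ := hq1
  simp only [Metric.mem_ball, dist_eq_norm, Set.mem_preimage] at hy hq2
  set s := ∑ i ∈ R.I₁, lam i • R.g i q.1
  -- `s` involves equality normals only, so no sign of `lam` is needed. Since `y + s` is close to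
  -- `v₀`, nonexpansiveness keeps `z` close to `y`.
  have hproj : IsProjOn (R.feasible q.1) (y + s) y :=
    isProjOn_of_mem_finsetCone hyf (I₁_subset_active hyf) ⟨lam, by simp, add_sub_cancel_left _ _⟩
  apply hball
  rw [Metric.mem_ball, dist_eq_norm]
  calc ‖z - x₀‖ = ‖(z - y) + (y - x₀)‖ := by rw [sub_add_sub_cancel]
    _ ≤ ‖z - y‖ + ‖y - x₀‖ := norm_add_le _ _
    _ ≤ ‖q.2 - (y + s)‖ + ‖y - x₀‖ := by gcongr; exact hz.norm_sub_le hproj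
    _ = ‖(q.2 - s - x₀) - (y - x₀)‖ + ‖y - x₀‖ := by congr 2; abel
    _ ≤ ‖q.2 - s - x₀‖ + ‖y - x₀‖ + ‖y - x₀‖ := by gcongr; exact norm_sub_le _ _
    _ < ε := by linarith

theorem RCRCQ.eventually_linearIndepOn (h : R.RCRCQ p₀ x₀) :
    ∀ᶠ p in 𝓝 p₀, ∀ J : Finset κ, R.I₁ ⊆ J → (J : Set κ) ⊆ R.active p₀ x₀ →
      LinearIndepOn ℝ (fun i => R.g i p) (J : Set κ) →
      LinearIndepOn ℝ (fun i => R.g i p₀) (J : Set κ) := by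
  obtain ⟨U, hU, h⟩ := h.2
  filter_upwards [hU] with p hp J hJ1 hJ2
  exact (linearIndepOn_iff_of_finrank_span_eq (h J hJ1 hJ2 p hp)).1

theorem RCRCQ.withEqualities (h : R.RCRCQ p₀ x₀) {K L : Finset κ}
    (hK : (K : Set κ) ⊆ R.active p₀ x₀) (hL : (L : Set κ) ⊆ R.active p₀ x₀) :
    (R.withEqualities K L).RCRCQ p₀ x₀ := by
  obtain ⟨hx, U, hU, hrank⟩ := h
  refine ⟨⟨fun i hi => ?_, fun i _ => inner_le_of_mem_feasible hx i⟩, U, hU, fun J hJ => hrank J ?_⟩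
  · rcases Finset.mem_union.1 hi with hi | hi
    · rcases Finset.mem_union.1 hi with hi | hi
      · exact hx.1 i hi
      · exact hK hi
    · exact hL hi
  · exact (Finset.subset_union_left.trans Finset.subset_union_left).trans hJ

end Continuity

end ConstraintSystem

/-! ### Lipschitz estimates for the moving set and its projection. -/

theorem LocallyLipschitz.eventually_dist_le {X Y : Type*} [PseudoMetricSpace X]
    [PseudoMetricSpace Y] {f : X → Y} (hf : LocallyLipschitz f) (x : X) :
    ∃ c : ℝ, ∀ᶠ q : X × X in 𝓝 (x, x), dist (f q.1) (f q.2) ≤ c * dist q.1 q.2 := by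
  obtain ⟨C, t, ht, h⟩ := hf x
  refine ⟨C, ?_⟩
  filter_upwards [prod_mem_nhds ht ht] with q hq
  exact h.dist_le_mul _ hq.1 _ hq.2

namespace ConstraintSystem

theorem IsLocallyLipschitz.eventually_dist_le {κ D H : Type*} [Finite κ] [PseudoMetricSpace D]
    [PseudoMetricSpace H] {R : ConstraintSystem κ D H} (h : R.IsLocallyLipschitz) (p₀ : D) :
    ∃ c : ℝ, 0 ≤ c ∧ ∀ᶠ q : D × D in 𝓝 (p₀, p₀), ∀ i,
      dist (R.f i q.1) (R.f i q.2) ≤ c * dist q.1 q.2 ∧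
      dist (R.g i q.1) (R.g i q.2) ≤ c * dist q.1 q.2 := by
  refine exists_uniform_constant ?_ fun i => ?_
  · rintro i c d q hcd ⟨h1, h2⟩
    exact ⟨h1.trans (by gcongr), h2.trans (by gcongr)⟩
  · obtain ⟨c, hc⟩ := (h.1 i).eventually_dist_le p₀
    obtain ⟨d, hd⟩ := (h.2 i).eventually_dist_le p₀
    refine ⟨max c d, ?_⟩
    filter_upwards [hc, hd] with q h1 h2
    exact ⟨h1.trans (by gcongr; exact le_max_left _ _),
      h2.trans (by gcongr; exact le_max_right _ _)⟩

variable {κ D H : Type*} [Fintype κ] [DecidableEq κ] [NormedAddCommGroup H]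
  [InnerProductSpace ℝ H] [PseudoMetricSpace D] {R : ConstraintSystem κ D H} {p₀ : D} {v₀ x₀ : H}

/-- At `p₁` each term would be nonpositive, so only the change of the data from `p₁` to `p₂`
contributes. -/
theorem sum_mul_slack_le {J : Finset κ} {p₁ p₂ : D} {x : H} {c : ℝ} {μ : κ → ℝ}
    (hμ : ∀ i ∈ J \ R.I₁, 0 ≤ μ i) (hx : x ∈ R.feasible p₁)
    (hlip : ∀ i, dist (R.f i p₁) (R.f i p₂) ≤ c * dist p₁ p₂ ∧
      dist (R.g i p₁) (R.g i p₂) ≤ c * dist p₁ p₂) :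
    ∑ i ∈ J, μ i * (inner ℝ x (R.g i p₂) - R.f i p₂) ≤
      (∑ i ∈ J, |μ i|) * ((‖x‖ + 1) * (c * dist p₁ p₂)) := by
  rw [Finset.sum_mul]
  refine Finset.sum_le_sum fun i hi => ?_
  obtain ⟨hf, hg⟩ := hlip i
  rw [Real.dist_eq] at hf
  rw [dist_eq_norm] at hg
  have h1 : |inner ℝ x (R.g i p₁ - R.g i p₂)| ≤ ‖x‖ * (c * dist p₁ p₂) :=
    (abs_real_inner_le_norm _ _).trans (by gcongr)
  rw [inner_sub_right] at h1
  rw [abs_le] at h1 hf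
  by_cases hi1 : i ∈ R.I₁
  · have h2 := hx.1 i hi1
    refine (le_abs_self _).trans ?_
    rw [abs_mul]
    refine mul_le_mul_of_nonneg_left ?_ (abs_nonneg _)
    rw [abs_le]
    constructor <;> linarith
  · have h2 := inner_le_of_mem_feasible hx i
    have h3 := hμ i (Finset.mem_sdiff.2 ⟨hi, hi1⟩)
    rw [abs_of_nonneg h3]
    refine mul_le_mul_of_nonneg_left ?_ h3
    linarith

/-- The Aubin property of the moving set at `(p₀, x₀)`. -/
theorem exists_eventually_exists_mem_feasible [CompleteSpace H] (hlip : R.IsLocallyLipschitz)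
    (hlin : LinearIndepOn ℝ (fun i => R.g i p₀) (R.I₁ : Set κ)) (hrank : R.RCRCQ p₀ x₀)
    (hlim : x₀ ∈ kuratowskiLiminf R.feasible p₀) :
    ∃ c : ℝ, ∀ᶠ q : (D × D) × H in 𝓝 ((p₀, p₀), x₀), q.2 ∈ R.feasible q.1.1 →
      ∃ z ∈ R.feasible q.1.2, ‖q.2 - z‖ ≤ c * dist q.1.1 q.1.2 := by
  have hf : ∀ i, ContinuousAt (R.f i) p₀ := fun i => (hlip.1 i).continuous.continuousAt
  have hg : ∀ i, ContinuousAt (R.g i) p₀ := fun i => (hlip.2 i).continuous.continuousAt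
  obtain ⟨c, hc0, hc⟩ := hlip.eventually_dist_le p₀
  obtain ⟨M, hM0, hM⟩ := exists_eventually_forall_sum_abs_le hg
  have hact := R.eventually_active_subset hf hg x₀
  rw [nhds_prod_eq, eventually_prod_iff] at hact
  obtain ⟨A, hA, V, hV, hact⟩ := hact
  have hnear := eventually_isProjOn_mem (R := R) hg hlim (v₀ := x₀) (lam := 0) (by simp) hV
  have hp2 : Tendsto (fun q : (D × D) × H => q.1.2) (𝓝 ((p₀, p₀), x₀)) (𝓝 p₀) :=
    (continuous_snd.comp continuous_fst).tendsto ((p₀, p₀), x₀)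
  have hp2x : Tendsto (fun q : (D × D) × H => (q.1.2, q.2)) (𝓝 ((p₀, p₀), x₀)) (𝓝 (p₀, x₀)) :=
    ((continuous_snd.comp continuous_fst).prodMk continuous_snd).tendsto ((p₀, p₀), x₀)
  have hp12 : Tendsto (fun q : (D × D) × H => q.1) (𝓝 ((p₀, p₀), x₀)) (𝓝 (p₀, p₀)) :=
    continuous_fst.tendsto ((p₀, p₀), x₀)
  have hnorm : ∀ᶠ q : (D × D) × H in 𝓝 ((p₀, p₀), x₀), ‖q.2‖ < ‖x₀‖ + 1 :=
    (continuous_snd.norm.tendsto ((p₀, p₀), x₀)).eventually_lt_const (lt_add_one _)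
  -- `‖x₀‖ + 2` bounds the factor `‖x‖ + 1` of `sum_mul_slack_le` for `x` near `x₀`.
  refine ⟨M * ((‖x₀‖ + 2) * c), ?_⟩
  filter_upwards [hp12.eventually hc, hp2.eventually hM, hp2.eventually hA,
    hp2x.eventually hnear, hp2.eventually hrank.eventually_linearIndepOn, hnorm,
    hp2.eventually (eventually_inter_nonempty_of_mem_kuratowskiLiminf hlim univ_mem)]
    with ⟨⟨p₁, p₂⟩, x⟩ hc hM hA hnear hrank hnorm hne hx
  obtain ⟨z, hz⟩ := exists_isProjOn (hne.mono Set.inter_subset_right) (R.isClosed_feasible p₂)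
    (R.convex_feasible p₂) x
  refine ⟨z, hz.1, ?_⟩
  obtain ⟨J, hJ1, hJ2, hJ3, μ, hμ, hxz⟩ := exists_linearIndepOn_mem_finsetCone_of_isProjOn
    (linearIndepOn_of_sum_abs_le (hM R.I₁ hlin)) hz
  have hJ4 := hrank J hJ1 (hJ2.trans (hact hA (hnear z hz))) hJ3
  have hM := hM J hJ4 μ
  rw [← hxz] at hM
  -- The constraints in `J` are active at `z`, so `⟪x - z, g i⟫` is the violation at `x`. The
  -- multipliers are bounded by `M * ‖x - z‖`, hence one factor `‖x - z‖` cancels below.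
  have hsq : ‖x - z‖ ^ 2 = ∑ i ∈ J, μ i * (inner ℝ x (R.g i p₂) - R.f i p₂) := by
    rw [← real_inner_self_eq_norm_sq]
    nth_rw 2 [hxz]
    rw [inner_sum]
    refine Finset.sum_congr rfl fun i hi => ?_
    have : inner ℝ z (R.g i p₂) = R.f i p₂ := hJ2 hi
    rw [real_inner_smul_right, inner_sub_left, this]
  have hle := sum_mul_slack_le hμ hx hc
  rw [← hsq] at hle
  dsimp only at hnorm hM ⊢
  have hB : (‖x‖ + 1) * (c * dist p₁ p₂) ≤ (‖x₀‖ + 2) * (c * dist p₁ p₂) :=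
    mul_le_mul_of_nonneg_right (by linarith) (by positivity)
  have hle2 : ‖x - z‖ ^ 2 ≤ M * ‖x - z‖ * ((‖x₀‖ + 2) * (c * dist p₁ p₂)) :=
    hle.trans (mul_le_mul hM hB (by positivity) (by positivity))
  rcases (norm_nonneg (x - z)).eq_or_lt with h0 | h0
  · rw [← h0]
    positivity
  · refine le_of_mul_le_mul_left ?_ h0
    linarith

variable [CompleteSpace H]

/-- Near the reference point, the projection satisfies the constraints in `K` as equalities and has
bounded multipliers on a set of linearly independent active normals that contains `K`. -/
theorem exists_eventually_exists_multipliers (hlip : R.IsLocallyLipschitz)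
    (hrank : R.RCRCQ p₀ x₀) {K : Finset κ}
    (hlin : LinearIndepOn ℝ (fun i => R.g i p₀) (↑(R.I₁ ∪ K) : Set κ)) {lam : κ → ℝ}
    (hlam : ∀ i ∈ K, 0 < lam i) (hv : v₀ - x₀ = ∑ i ∈ R.I₁ ∪ K, lam i • R.g i p₀)
    (hlim : x₀ ∈ kuratowskiLiminf (R.withEqualities K ∅).feasible p₀) {V : Set H}
    (hV : V ∈ 𝓝 x₀) :
    ∃ B : ℝ, ∀ᶠ q : D × H in 𝓝 (p₀, v₀), ∃ x ∈ V, ∃ J : Finset κ, R.I₁ ∪ K ⊆ J ∧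
      (J : Set κ) ⊆ R.active p₀ x₀ ∧ LinearIndepOn ℝ (fun i => R.g i p₀) (J : Set κ) ∧
      x ∈ R.feasible q.1 ∧ (J : Set κ) ⊆ R.active q.1 x ∧ ∃ μ : κ → ℝ,
        (∀ i ∈ J \ R.I₁, 0 ≤ μ i) ∧ ∑ i ∈ J, |μ i| ≤ B ∧ q.2 - x = ∑ i ∈ J, μ i • R.g i q.1 := by
  have hf : ∀ i, ContinuousAt (R.f i) p₀ := fun i => (hlip.1 i).continuous.continuousAt
  have hg : ∀ i, ContinuousAt (R.g i) p₀ := fun i => (hlip.2 i).continuous.continuousAt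
  obtain ⟨M, hM0, hM⟩ := exists_eventually_forall_sum_abs_le hg
  have hS : (R.withEqualities K ∅).I₁ = R.I₁ ∪ K := Finset.union_empty _
  -- The residual of the reference multipliers: it vanishes at the reference point, and `M * ‖F‖`
  -- controls how far the actual multipliers are from `lam`.
  let F : (D × H) × H → H := fun q => q.1.2 - q.2 - ∑ i ∈ R.I₁ ∪ K, lam i • R.g i q.1.1
  have hF : Tendsto (fun q => M * ‖F q‖) (𝓝 ((p₀, v₀), x₀)) (𝓝 0) := by
    have h1 : ContinuousAt F ((p₀, v₀), x₀) :=
      ((continuous_snd.comp continuous_fst).sub continuous_snd).continuousAt.sub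
        (tendsto_finsetSum _ fun i _ => tendsto_const_nhds.smul
          ((hg i).comp_of_eq (continuous_fst.comp continuous_fst).continuousAt rfl))
    have h2 := (h1.norm.tendsto).const_mul M
    simpa only [F, hv, sub_self, norm_zero, mul_zero] using h2
  have hev : ∀ᶠ q in 𝓝 ((p₀, v₀), x₀), M * ‖F q‖ < 1 ∧ ∀ i ∈ K, M * ‖F q‖ < lam i :=
    (hF.eventually_lt_const one_pos).and
      ((Finset.eventually_all K).2 fun i hi => hF.eventually_lt_const (hlam i hi))
  rw [nhds_prod_eq, eventually_prod_iff] at hev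
  obtain ⟨A₁, hA₁, V₁, hV₁, hres⟩ := hev
  have hact := R.eventually_active_subset hf hg x₀
  rw [nhds_prod_eq, eventually_prod_iff] at hact
  obtain ⟨A₂, hA₂, V₂, hV₂, hact⟩ := hact
  have hnear := eventually_isProjOn_mem (R := R.withEqualities K ∅) hg hlim (hS ▸ hv)
    (inter_mem hV (inter_mem hV₁ hV₂))
  have hne := eventually_inter_nonempty_of_mem_kuratowskiLiminf hlim univ_mem
  have hfst : Tendsto (fun q : D × H => q.1) (𝓝 (p₀, v₀)) (𝓝 p₀) :=
    continuous_fst.tendsto (p₀, v₀)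
  refine ⟨1 + ∑ i ∈ R.I₁ ∪ K, |lam i|, ?_⟩
  filter_upwards [hA₁, hfst.eventually hA₂, hnear, hfst.eventually hne, hfst.eventually hM,
    hfst.eventually hrank.eventually_linearIndepOn] with ⟨p, v⟩ hA₁ hA₂ hnear hne hM hrank
  obtain ⟨x, hx⟩ := exists_isProjOn (hne.mono Set.inter_subset_right)
    ((R.withEqualities K ∅).isClosed_feasible p) ((R.withEqualities K ∅).convex_feasible p) v
  obtain ⟨hxV, hxV₁, hxV₂⟩ := hnear x hx
  obtain ⟨J, hJ1, hJ2, hJ3, μ, hμ, hvx⟩ := exists_linearIndepOn_mem_finsetCone_of_isProjOn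
    (R := R.withEqualities K ∅) (hS ▸ linearIndepOn_of_sum_abs_le (hM _ hlin)) hx
  rw [hS] at hJ1 hμ
  have hJ4 : (J : Set κ) ⊆ R.active p₀ x₀ := hJ2.trans (hact hA₂ hxV₂)
  have hJ5 := hrank J (Finset.subset_union_left.trans hJ1) hJ4 hJ3
  obtain ⟨hres1, hresK⟩ := hres hA₁ hxV₁
  -- Extension of `lam` by zero, so that `μ - ν` are the coefficients of `F` over the independent
  -- family `J`.
  set ν : κ → ℝ := fun i => if i ∈ R.I₁ ∪ K then lam i else 0 with hν
  have hdiff : ∑ i ∈ J, |μ i - ν i| ≤ M * ‖F ((p, v), x)‖ := by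
    have h := hM J hJ5 fun i => μ i - ν i
    have hsum : ∑ i ∈ J, ν i • R.g i p = ∑ i ∈ R.I₁ ∪ K, lam i • R.g i p := by
      simp only [hν, ite_smul, zero_smul, Finset.sum_ite_mem, Finset.inter_eq_right.2 hJ1]
    have hvx' : v - x = ∑ i ∈ J, μ i • R.g i p := hvx
    simp only [sub_smul, Finset.sum_sub_distrib, hsum, ← hvx'] at h
    exact h
  refine ⟨x, hxV, J, hJ1, hJ4, hJ5, feasible_withEqualities_subset K ∅ p hx.1, hJ2, μ,
    fun i hi => ?_, ?_, hvx⟩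
  · rw [Finset.mem_sdiff] at hi
    by_cases hiK : i ∈ K
    · have h1 := (Finset.single_le_sum (fun i _ => abs_nonneg (μ i - ν i)) hi.1).trans hdiff
      have h2 := hresK i hiK
      have h3 : ν i = lam i := if_pos (Finset.mem_union_right _ hiK)
      rw [h3] at h1
      linarith [(abs_le.1 h1).1]
    · refine hμ i (Finset.mem_sdiff.2 ⟨hi.1, fun h => ?_⟩)
      rcases Finset.mem_union.1 h with h | h
      exacts [hi.2 h, hiK h]
  · have hνsum : ∑ i ∈ J, |ν i| = ∑ i ∈ R.I₁ ∪ K, |lam i| := by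
      simp only [hν, apply_ite abs, abs_zero, Finset.sum_ite_mem, Finset.inter_eq_right.2 hJ1]
    calc ∑ i ∈ J, |μ i| ≤ ∑ i ∈ J, (|μ i - ν i| + |ν i|) := Finset.sum_le_sum fun i _ => by
          simpa using abs_add_le (μ i - ν i) (ν i)
      _ ≤ 1 + ∑ i ∈ R.I₁ ∪ K, |lam i| := by
          rw [Finset.sum_add_distrib, hνsum]
          linarith

/-- Lipschitz dependence of the projection on the parameter, for fixed argument. -/
theorem exists_eventually_norm_isProjOn_sub_le (hlip : R.IsLocallyLipschitz)
    (hrank : R.RCRCQ p₀ x₀) {K : Finset κ} (hK : (K : Set κ) ⊆ R.active p₀ x₀)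
    (hlin : LinearIndepOn ℝ (fun i => R.g i p₀) (↑(R.I₁ ∪ K) : Set κ)) {lam : κ → ℝ}
    (hlam : ∀ i ∈ K, 0 < lam i) (hv : v₀ - x₀ = ∑ i ∈ R.I₁ ∪ K, lam i • R.g i p₀)
    (hlim : ∀ L : Finset κ, L ⊆ R.I₂ \ K → (L : Set κ) ⊆ R.active p₀ x₀ →
      LinearIndepOn ℝ (fun i => R.g i p₀) (↑(R.I₁ ∪ K ∪ L) : Set κ) →
      x₀ ∈ kuratowskiLiminf (R.withEqualities K L).feasible p₀) :
    ∃ c : ℝ, 0 ≤ c ∧ ∀ᶠ q : (D × D) × H in 𝓝 ((p₀, p₀), v₀), ∀ x₁ x₂,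
      IsProjOn (R.feasible q.1.1) q.2 x₁ → IsProjOn (R.feasible q.1.2) q.2 x₂ →
        ‖x₁ - x₂‖ ≤ c * dist q.1.1 q.1.2 := by
  obtain ⟨c₀, hc₀0, hc₀⟩ := hlip.eventually_dist_le p₀
  have haubin : ∃ c : ℝ, 0 ≤ c ∧ ∀ᶠ q : (D × D) × H in 𝓝 ((p₀, p₀), x₀), ∀ J : Finset κ,
      (R.I₁ ∪ K ⊆ J ∧ (J : Set κ) ⊆ R.active p₀ x₀ ∧
        LinearIndepOn ℝ (fun i => R.g i p₀) (J : Set κ)) →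
      q.2 ∈ R.feasible q.1.1 → (J : Set κ) ⊆ R.active q.1.1 q.2 →
      ∃ z ∈ R.feasible q.1.2, (J : Set κ) ⊆ R.active q.1.2 z ∧
        ‖q.2 - z‖ ≤ c * dist q.1.1 q.1.2 := by
    refine exists_uniform_constant ?_ fun J => ?_
    · intro J c d q hcd h hJ hx hact
      obtain ⟨z, hz, hz1, hz2⟩ := h hJ hx hact
      exact ⟨z, hz, hz1, hz2.trans (by gcongr)⟩
    by_cases hJ : R.I₁ ∪ K ⊆ J ∧ (J : Set κ) ⊆ R.active p₀ x₀ ∧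
        LinearIndepOn ℝ (fun i => R.g i p₀) (J : Set κ)
    · obtain ⟨hJ1, hJ2, hJ3⟩ := hJ
      -- For this `L` the equality constraints of `R_{K,L}` are exactly those in `J`.
      set L := J \ (R.I₁ ∪ K) with hL
      have hLact : (L : Set κ) ⊆ R.active p₀ x₀ :=
        fun i hi => hJ2 (Finset.sdiff_subset (Finset.mem_coe.1 hi))
      have hunion : R.I₁ ∪ K ∪ L = J := Finset.union_sdiff_of_subset hJ1
      have hS : (R.withEqualities K L).I₁ = J := hunion
      have hLsub : L ⊆ R.I₂ \ K := fun i hi => by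
        simp only [hL, Finset.mem_sdiff, Finset.mem_union, not_or] at hi
        exact Finset.mem_sdiff.2 ⟨R.mem_I₂.2 hi.2.1, hi.2.2⟩
      obtain ⟨c, hc⟩ := exists_eventually_exists_mem_feasible (R := R.withEqualities K L) hlip
        (hS.symm ▸ hJ3) (hrank.withEqualities hK hLact)
        (hlim L hLsub hLact (hunion.symm ▸ hJ3))
      refine ⟨c, hc.mono fun q hq _ hx hact => ?_⟩
      obtain ⟨z, hz, hzc⟩ := hq
        ⟨fun i hi => hact (hS ▸ hi), fun i _ => inner_le_of_mem_feasible hx i⟩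
      exact ⟨z, feasible_withEqualities_subset K L _ hz,
        fun i hi => hz.1 i (hS.symm ▸ hi), hzc⟩
    · exact ⟨0, Eventually.of_forall fun q h => absurd h hJ⟩
  obtain ⟨c, hc0, haubin⟩ := haubin
  rw [nhds_prod_eq, eventually_prod_iff] at haubin
  obtain ⟨A, hA, V, hV, haubin⟩ := haubin
  have hlim0 := hlim ∅ (Finset.empty_subset _) (by simp) (by rwa [Finset.union_empty])
  obtain ⟨B, hB⟩ := exists_eventually_exists_multipliers hlip hrank hlin hlam hv hlim0 hV
  have hq1 : Tendsto (fun q : (D × D) × H => (q.1.1, q.2)) (𝓝 ((p₀, p₀), v₀)) (𝓝 (p₀, v₀)) :=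
    ((continuous_fst.comp continuous_fst).prodMk continuous_snd).tendsto ((p₀, p₀), v₀)
  have hq12 : Tendsto (fun q : (D × D) × H => q.1) (𝓝 ((p₀, p₀), v₀)) (𝓝 (p₀, p₀)) :=
    continuous_fst.tendsto ((p₀, p₀), v₀)
  -- One `c` for `x₁` to `z`; the bracket bounds `z` to `x₂`, with `|B| * c₀` from moving the
  -- normals under multipliers of total size at most `B`.
  refine ⟨c + (c + |B| * c₀), by positivity, ?_⟩
  filter_upwards [hq12.eventually hc₀, hq12.eventually hA, hq1.eventually hB]
    with ⟨⟨p₁, p₂⟩, v⟩ hc₀ hA hB x₁ x₂ hx₁ hx₂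
  obtain ⟨x, hxV, J, hJ1, hJ2, hJ3, hx, hJ4, μ, hμ, hμB, hvx⟩ := hB
  obtain rfl : x₁ = x := hx₁.unique (isProjOn_of_mem_finsetCone hx hJ4 ⟨μ, hμ, hvx⟩)
  obtain ⟨z, hz, hJz, hxz⟩ := haubin hA hxV J ⟨hJ1, hJ2, hJ3⟩ hx hJ4
  have hproj : IsProjOn (R.feasible p₂) (z + ∑ i ∈ J, μ i • R.g i p₂) z :=
    isProjOn_of_mem_finsetCone hz hJz ⟨μ, hμ, add_sub_cancel_left _ _⟩
  dsimp only at hvx hxz ⊢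
  have h1 : ‖z - x₂‖ ≤ ‖(z - x₁) + ∑ i ∈ J, μ i • (R.g i p₂ - R.g i p₁)‖ := by
    refine (hproj.norm_sub_le hx₂).trans (le_of_eq ?_)
    simp only [smul_sub, Finset.sum_sub_distrib, ← hvx]
    congr 1
    abel
  have h2 : ‖∑ i ∈ J, μ i • (R.g i p₂ - R.g i p₁)‖ ≤ |B| * (c₀ * dist p₁ p₂) := by
    refine (norm_sum_smul_le (ε := c₀ * dist p₁ p₂) (fun i _ => ?_) μ).trans ?_
    · rw [norm_sub_rev, ← dist_eq_norm]
      exact (hc₀ i).2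
    · exact mul_le_mul_of_nonneg_right (hμB.trans (le_abs_self B)) (by positivity)
  have h3 := norm_add_le (z - x₁) (∑ i ∈ J, μ i • (R.g i p₂ - R.g i p₁))
  have h4 := norm_add_le (x₁ - z) (z - x₂)
  rw [sub_add_sub_cancel] at h4
  rw [norm_sub_rev z x₁] at h3
  linarith

end ConstraintSystem

/-! ### Assembly: variation in `v`, then in `p`. -/

theorem theorem5p3
    {H : Type*} [NormedAddCommGroup H] [InnerProductSpace ℝ H] [CompleteSpace H]
    {G : Type*} [NormedAddCommGroup G] [NormedSpace ℝ G] (D : Set G)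
    {ι : Type*} [Fintype ι] [DecidableEq ι] [Nonempty ι]
    (C : ConstraintSystem ι D H) (hC : C.IsLocallyLipschitz)
    (p₀ : D) (v₀ x₀ : H) (hv₀ : v₀ ∉ C.feasible p₀)
    (hR : ∃ (m : ℕ) (R : ConstraintSystem (Fin m) D H), 0 < m ∧
      R.IsEquivalentRepresentation C ∧ R.RCRCQ p₀ x₀ ∧ R.IsStableRepresentation C p₀ v₀ x₀) :
    ∃ W ∈ 𝓝 v₀, ∃ U ∈ 𝓝 p₀, ∃ l : ℝ, 0 < l ∧
      (∀ p ∈ U, ∀ v : H, ∃! x, C.IsSolution v p x) ∧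
      ∀ v₁ ∈ W, ∀ v₂ ∈ W, ∀ p₁ ∈ U, ∀ p₂ ∈ U,
        ‖(v₁ - v₂) - (2 : ℝ) • (C.proj v₁ p₁ - C.proj v₂ p₂)‖
            ≤ ‖v₁ - v₂‖ + l * ‖(p₁ : G) - (p₂ : G)‖ ∧
        ‖C.proj v₁ p₁ - C.proj v₂ p₂‖ ≤ ‖v₁ - v₂‖ + l / 2 * ‖(p₁ : G) - (p₂ : G)‖ := by
  obtain ⟨m, R, -, ⟨hlip, hfeas⟩, hrank, K, -, -, -, -, hK, hlin, ⟨lam, hlam, hv⟩, hlim⟩ := hR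
  obtain ⟨c, hc0, hc⟩ := R.exists_eventually_norm_isProjOn_sub_le hlip hrank hK hlin hlam hv hlim
  have hne := eventually_inter_nonempty_of_mem_kuratowskiLiminf
    (hlim ∅ (Finset.empty_subset _) (by simp) (by rwa [Finset.union_empty])) univ_mem
  rw [nhds_prod_eq, nhds_prod_eq, eventually_prod_iff] at hc
  obtain ⟨A, hA, W, hW, hc⟩ := hc
  obtain ⟨A', hA', hAA⟩ := eventually_prod_self_iff'.1 hA
  have hexists : ∀ p, (Set.univ ∩ (R.withEqualities K ∅).feasible p).Nonempty → ∀ v : H,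
      ∃ x, IsProjOn (C.feasible p) v x := fun p hp v =>
    exists_isProjOn (hp.mono fun x hx => hfeas p ▸
      ConstraintSystem.feasible_withEqualities_subset K ∅ p hx.2)
      (C.isClosed_feasible p) (C.convex_feasible p) v
  -- The factor 2 comes from the reflection; the added 1 makes the constant positive even when `c =
  -- 0`.
  refine ⟨{v | W v}, hW, {p | p ∈ A' ∧
    (Set.univ ∩ (R.withEqualities K ∅).feasible p).Nonempty}, inter_mem hA' hne, 2 * c + 1,
    by positivity, fun p hp v => ?_, fun v₁ hv₁ v₂ hv₂ p₁ hp₁ p₂ hp₂ => ?_⟩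
  · obtain ⟨x, hx⟩ := hexists p hp.2 v
    exact ⟨x, C.isSolution_iff.2 hx, fun y hy => (C.isSolution_iff.1 hy).unique hx⟩
  have h11 := ConstraintSystem.isProjOn_proj (hexists p₁ hp₁.2 v₁)
  have h21 := ConstraintSystem.isProjOn_proj (hexists p₁ hp₁.2 v₂)
  have h22 := ConstraintSystem.isProjOn_proj (hexists p₂ hp₂.2 v₂)
  have hp : ‖C.proj v₂ p₁ - C.proj v₂ p₂‖ ≤ c * ‖(p₁ : G) - (p₂ : G)‖ := by
    have := hc (hAA p₁ hp₁.1 p₂ hp₂.1) hv₂ _ _ ((hfeas p₁).symm ▸ h21) ((hfeas p₂).symm ▸ h22)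
    rwa [Subtype.dist_eq, dist_eq_norm] at this
  have hd := norm_nonneg ((p₁ : G) - (p₂ : G))
  constructor
  -- The intermediate point is `C.proj v₂ p₁`: both projections at `p₁` are onto the same set, so no
  -- parameter error enters the first difference.
  · calc ‖(v₁ - v₂) - (2 : ℝ) • (C.proj v₁ p₁ - C.proj v₂ p₂)‖
        = ‖((v₁ - v₂) - (2 : ℝ) • (C.proj v₁ p₁ - C.proj v₂ p₁)) -
            (2 : ℝ) • (C.proj v₂ p₁ - C.proj v₂ p₂)‖ := by
          congr 1
          module
      _ ≤ ‖v₁ - v₂‖ + 2 * (c * ‖(p₁ : G) - (p₂ : G)‖) := by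
          refine (norm_sub_le _ _).trans (add_le_add (h11.norm_reflection_le h21) ?_)
          rw [norm_smul, Real.norm_two]
          gcongr
      _ ≤ ‖v₁ - v₂‖ + (2 * c + 1) * ‖(p₁ : G) - (p₂ : G)‖ := by linarith
  · calc ‖C.proj v₁ p₁ - C.proj v₂ p₂‖
        = ‖(C.proj v₁ p₁ - C.proj v₂ p₁) + (C.proj v₂ p₁ - C.proj v₂ p₂)‖ := by
          rw [sub_add_sub_cancel]
      _ ≤ ‖v₁ - v₂‖ + c * ‖(p₁ : G) - (p₂ : G)‖ :=
          (norm_add_le _ _).trans (add_le_add (h11.norm_sub_le h21) hp)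
      _ ≤ ‖v₁ - v₂‖ + (2 * c + 1) / 2 * ‖(p₁ : G) - (p₂ : G)‖ := by linarith
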